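/- An \emph{RV-sort} is a set $\mathcal H$ with two binary operations $\oplus,\cdot$ and two constants $\mathbf 0,\mathbf 1$ such that $\cdot$ is commutative on $\mathcal H$ and (RV1) $\mathcal H^\times:=\mathcal H\setminus\{\mathbf 0\}$ is an abelian group under $\cdot$ with neutral element $\mathbf 1$; (RV2) $\mathbf 0\oplus a=a$ for all $a$; (RV3) if $(a\oplus b)\oplus c\neq a\oplus(b\oplus c)$, then $a\oplus b=\mathbf 0$ or $b\oplus c=\mathbf 0$; (RV4) $a\oplus b=b\oplus a$ for all $a,b$; (RV5) $(a\oplus b)\cdot c=ac\oplus bc$ for all $a,b,c$; (RV6) with $\mathcal F^\times:=\{r\in\mathcal H^\times : \mathbf 1\oplus r\ne\mathbf 1\text{ and }\mathbf 1\oplus r^{-1}\neq\mathbf 1\}$, the set $\mathcal F:=\mathcal F^\times\cup\{\mathbf 0\}$ is closed under $\oplus$ and $\cdot$, and is a field for the restrictions of these operations, with zero $\mathbf 0$ and unit $\mathbf 1$; (RV7) for all $a\in\mathcal H$ and $r\in\mathcal F^\times$: $a\oplus\mathbf 1=\mathbf 1$ if and only if $a\oplus r=r$. These axioms imply that $\Gamma:=\mathcal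 H^\times/\mathcal F^\times$, written additively, is an ordered abelian group for the order defined by $[a]<[b]\iff a\oplus b=a$. Put $\mathrm{val}_{\mathcal H}(a):=[a]\in\Gamma$ for $a\neq\mathbf 0$ and $\mathrm{val}_{\mathcal H}(\mathbf 0):=\infty>\Gamma$. The RV-sort $\mathcal H$ is regarded as a valued hyperfield with the multiplication $\cdot$, the valuation $\mathrm{val}_{\mathcal H}$, and the hyperaddition $$a\boxplus b=\begin{cases}\{\mathbf 0\}\cup\{x\in\mathcal H:\mathrm{val}_{\mathcal H}(x)>\mathrm{val}_{\mathcal H}(a)\}&\text{if }a\oplus b=\mathbf 0,\\ \{a\oplus b\}&\text{otherwise.}\end{cases}$$ Let $\mathcal H^{(\Gamma)}$ be the set of all families $a=(a_\gamma)_{\gamma\in\Gamma}$ of elements of $\mathcal H$ such that $\mathrm{val}_{\mathcal H}(a_\gamma)\in\{\gamma,\infty\}$ for all $\gamma\in\Gamma$ and such that the support $\mathrm{supp}(a)=\{\gamma\in\Gamma: a_\gamma\neq\mathbf 0\}$ is well-ordered. Put $$(a+b)_\gamma=a_\gamma\oplus b_\gamma,\qquad (a\cdot b)_\gamma=\bigoplus_{\delta+\varepsilon=\gamma}a_\delta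 b_\varepsilon ,$$ where the second sum has only finitely many nonzero terms, all of value $\gamma$, and does not depend on the order of summation or on parentheses. Let $0$ be the family with all entries $\mathbf 0$, let $1$ be the family with entry $\mathbf 1$ at $\gamma=0$ and $\mathbf 0$ elsewhere, and put $\mathrm{val}(a):=\min\mathrm{supp}(a)$ for $a\ne 0$ and $\mathrm{val}(0):=\infty$. \textbf{Proposition.} Let $\mathcal H$ be an RV-sort. Then $(\mathcal H^{(\Gamma)},+,\cdot,0,1)$ is a field, $\mathrm{val}$ is a valuation on it, and its valuation ring is henselian. Moreover, let $T:=1+\mathfrak m$, where $\mathfrak m=\{x\in\mathcal H^{(\Gamma)}:\mathrm{val}(x)>0\}$, and let $\mathcal H_{\{0\}}(\mathcal H^{(\Gamma)})$ be the valued factor hyperfield of $\mathcal H^{(\Gamma)}$ modulo $T$: it consists of the cosets $[x]=xT$ of the nonzero elements $x$ together with $[0]=\{0\}$, with $[x][y]=[xy]$, $[x]+[y]=\{[x+yt]:t\in T\}$, and the valuation $[x]\mapsto\mathrm{val}(x)$. Then there is an isomorphism of valued hyperfields $$\mathcal H_{\{0\}}(\mathcal H^{(\Gamma)})\cong\mathcal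 H ,$$ that is, a bijection that preserves $0$, $1$, the multiplication, the hyperaddition, and the valuation. -/

import Mathlib

/-- A structure in the language with two binary function symbols `⊕`, `·` and two constants
`0`, `1`. -/
class RVStructure (H : Type*) extends Zero H, One H, Mul H where
  oplus : H → H → H

infixl:65 " ⊕ᵣ " => RVStructure.oplus

/-- `r` lies in `Fˣ`: it is nonzero, `1 ⊕ r ≠ 1`, and `1 ⊕ s ≠ 1` for the inverse `s` of `r`. -/
def ResUnit {H : Type*} [RVStructure H] (r : H) : Prop :=
  r ≠ 0 ∧ (1 : H) ⊕ᵣ r ≠ 1 ∧ ∀ s : H, s ≠ 0 → r * s = 1 → (1 : H) ⊕ᵣ s ≠ 1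

/-- The set `F = Fˣ ∪ {0}`, as a type. -/
@[ext]
structure ResField (H : Type*) [RVStructure H] where
  val : H
  property : val = 0 ∨ ResUnit val

/-- RV-sorts. The multiplication is commutative, the nonzero elements form a group under it
(first six axioms), and `⊕` is a commutative, distributive, half-associative operation with
neutral element `0`, which restricts to the addition of a field on `F` and which satisfies uniform
additive absorption. -/
class RVSort (H : Type*) extends RVStructure H where
  rv_mul_comm : ∀ a b : H, a * b = b * a
  rv_mul_ne_zero : ∀ a b : H, a ≠ 0 → b ≠ 0 → a * b ≠ 0
  rv_mul_assoc : ∀ a b c : H, a ≠ 0 → b ≠ 0 → c ≠ 0 → a * b * c = a * (b * c)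
  rv_one_ne_zero : (1 : H) ≠ 0
  rv_one_mul : ∀ a : H, a ≠ 0 → 1 * a = a
  rv_exists_inv : ∀ a : H, a ≠ 0 → ∃ b : H, b ≠ 0 ∧ a * b = 1
  zero_oplus : ∀ a : H, (0 : H) ⊕ᵣ a = a
  oplus_half_assoc : ∀ a b c : H, (a ⊕ᵣ b) ⊕ᵣ c ≠ a ⊕ᵣ (b ⊕ᵣ c) → a ⊕ᵣ b = 0 ∨ b ⊕ᵣ c = 0
  oplus_comm : ∀ a b : H, a ⊕ᵣ b = b ⊕ᵣ a
  oplus_mul : ∀ a b c : H, (a ⊕ᵣ b) * c = a * c ⊕ᵣ b * c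
  /-- `F` is closed under `⊕` and `·` and is a field for the restrictions of these operations,
  with zero `0` and unit `1`. -/
  resField_isField : ∃ _ : Field (ResField H),
    (∀ x y : ResField H, (x + y).1 = x.1 ⊕ᵣ y.1) ∧ (∀ x y : ResField H, (x * y).1 = x.1 * y.1) ∧
    (0 : ResField H).1 = 0 ∧ (1 : ResField H).1 = 1
  uniform_absorption : ∀ a r : H, ResUnit r → (a ⊕ᵣ 1 = 1 ↔ a ⊕ᵣ r = r)

namespace RVSort

variable {H : Type*} [RVSort H]

theorem resUnit_one : ResUnit (1 : H) := by
  obtain ⟨_, -, -, -, h1⟩ := resField_isField (H := H)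
  rcases (1 : ResField H).2 with h | h
  · exact absurd (h1.symm.trans h) rv_one_ne_zero
  · rwa [h1] at h

theorem one_oplus_one : (1 : H) ⊕ᵣ 1 ≠ 1 := resUnit_one.2.1

theorem rv_zero_mul (a : H) : 0 * a = 0 := by
  by_contra h
  obtain ⟨b, -, hab⟩ := rv_exists_inv _ h
  have h1 : (0 : H) * a = 0 * a ⊕ᵣ 0 * a := by
    conv_lhs => rw [← zero_oplus (0 : H), oplus_mul]
  have h2 := congrArg (· * b) h1
  simp only [oplus_mul, hab] at h2
  exact one_oplus_one h2.symm

theorem rv_mul_zero (a : H) : a * 0 = 0 := by rw [rv_mul_comm, rv_zero_mul]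

open Classical in
/-- An RV-sort with its multiplication is an abelian group with an absorbing zero; the inverse of
`0` is `0` by convention. -/
noncomputable instance instCommGroupWithZero : CommGroupWithZero H where
  mul_assoc a b c := by
    by_cases ha : a = 0
    · simp [ha, rv_zero_mul]
    by_cases hb : b = 0
    · simp [hb, rv_zero_mul, rv_mul_zero]
    by_cases hc : c = 0
    · simp [hc, rv_mul_zero]
    exact rv_mul_assoc a b c ha hb hc
  one_mul a := by
    by_cases ha : a = 0
    · simp [ha, rv_mul_zero]
    exact rv_one_mul a ha
  mul_one a := by
    rw [rv_mul_comm]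
    by_cases ha : a = 0
    · simp [ha, rv_mul_zero]
    exact rv_one_mul a ha
  mul_comm := rv_mul_comm
  zero_mul := rv_zero_mul
  mul_zero := rv_mul_zero
  inv a := if h : a = 0 then 0 else (rv_exists_inv a h).choose
  exists_pair_ne := ⟨1, 0, rv_one_ne_zero⟩
  inv_zero := by simp
  mul_inv_cancel a ha := by
    simp only [dif_neg ha]
    exact (rv_exists_inv a ha).choose_spec.2

theorem oplus_zero (a : H) : a ⊕ᵣ 0 = a := by rw [oplus_comm, zero_oplus]

theorem mul_oplus (a b c : H) : a * (b ⊕ᵣ c) = a * b ⊕ᵣ a * c := by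
  rw [mul_comm, oplus_mul, mul_comm b, mul_comm c]

theorem resUnit_iff (r : H) : ResUnit r ↔ r ≠ 0 ∧ (1 : H) ⊕ᵣ r ≠ 1 ∧ (1 : H) ⊕ᵣ r⁻¹ ≠ 1 := by
  refine and_congr_right fun h0 => and_congr_right fun _ => ⟨fun h => ?_, fun h s _ hs => ?_⟩
  · exact h _ (inv_ne_zero h0) (mul_inv_cancel₀ h0)
  · rwa [eq_inv_of_mul_eq_one_right hs]

theorem resUnit_inv {r : H} (h : ResUnit r) : ResUnit r⁻¹ := by
  rw [resUnit_iff] at h ⊢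
  exact ⟨inv_ne_zero h.1, h.2.2, by simpa using h.2.1⟩

theorem resUnit_mul {r s : H} (hr : ResUnit r) (hs : ResUnit s) : ResUnit (r * s) := by
  obtain ⟨_, -, hm, -, -⟩ := resField_isField (H := H)
  have := ((⟨r, Or.inr hr⟩ : ResField H) * ⟨s, Or.inr hs⟩).2
  rw [hm] at this
  exact this.resolve_left (mul_ne_zero hr.1 hs.1)

theorem resUnit_oplus {r s : H} (hr : ResUnit r) (hs : ResUnit s) :
    r ⊕ᵣ s = 0 ∨ ResUnit (r ⊕ᵣ s) := by
  obtain ⟨_, ha, -, -, -⟩ := resField_isField (H := H)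
  have := ((⟨r, Or.inr hr⟩ : ResField H) + ⟨s, Or.inr hs⟩).2
  rwa [ha] at this

theorem resUnit_oplus_assoc {r s t : H} (hr : ResUnit r) (hs : ResUnit s) (ht : ResUnit t) :
    (r ⊕ᵣ s) ⊕ᵣ t = r ⊕ᵣ (s ⊕ᵣ t) := by
  obtain ⟨_, ha, -, -, -⟩ := resField_isField (H := H)
  have := congrArg ResField.val
    (add_assoc (⟨r, Or.inr hr⟩ : ResField H) ⟨s, Or.inr hs⟩ ⟨t, Or.inr ht⟩)
  simpa only [ha] using this

variable (H) in
/-- `Fˣ` as a subgroup of `Hˣ`. -/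
noncomputable def resUnits : Subgroup Hˣ where
  carrier := {u | ResUnit (u : H)}
  mul_mem' ha hb := by
    simpa using resUnit_mul ha hb
  one_mem' := by simpa using resUnit_one
  inv_mem' ha := by
    simpa using resUnit_inv ha

variable (H) in
/-- The value group `Γ = Hˣ / Fˣ`, written additively. -/
def ValueGroup : Type _ := Additive (Hˣ ⧸ resUnits H)

noncomputable instance : AddCommGroup (ValueGroup H) :=
  inferInstanceAs (AddCommGroup (Additive (Hˣ ⧸ resUnits H)))

/-- The class of a unit in the value group. -/
noncomputable def toValueGroup (a : Hˣ) : ValueGroup H := Additive.ofMul (QuotientGroup.mk a)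

theorem toValueGroup_mul (a b : Hˣ) :
    toValueGroup (a * b) = toValueGroup a + toValueGroup b := rfl

theorem toValueGroup_surjective : Function.Surjective (toValueGroup (H := H)) := fun x =>
  QuotientGroup.mk_surjective (Additive.toMul x)

theorem toValueGroup_eq_iff (a b : Hˣ) :
    toValueGroup a = toValueGroup b ↔ ResUnit ((a : H)⁻¹ * b) := by
  change (QuotientGroup.mk a : Hˣ ⧸ resUnits H) = QuotientGroup.mk b ↔ _
  rw [QuotientGroup.eq]
  change ResUnit (((a⁻¹ * b : Hˣ)) : H) ↔ _
  rw [Units.val_mul, Units.val_inv_eq_inv_val]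

theorem oplus_eq_left_iff (a b : Hˣ) :
    (a : H) ⊕ᵣ b = a ↔ (1 : H) ⊕ᵣ (a : H)⁻¹ * b = 1 := by
  rw [← mul_right_inj' (a := (a : H)) a.ne_zero (b := 1 ⊕ᵣ _), mul_oplus, mul_one,
    mul_inv_cancel_left₀ a.ne_zero]

theorem absorbs_congr {a a' b b' : Hˣ} (ha : toValueGroup a = toValueGroup a')
    (hb : toValueGroup b = toValueGroup b') (h : (a : H) ⊕ᵣ b = a) : (a' : H) ⊕ᵣ b' = a' := by
  rw [toValueGroup_eq_iff] at ha hb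
  have ha0 := a.ne_zero
  have ha0' := a'.ne_zero
  have hb0 := b.ne_zero
  have hb0' := b'.ne_zero
  have h1 : (a : H)⁻¹ * b ⊕ᵣ 1 = 1 := by
    rwa [oplus_eq_left_iff, oplus_comm] at h
  have hr : ResUnit (((b : H)⁻¹ * b')⁻¹ * ((a : H)⁻¹ * a')) := resUnit_mul (resUnit_inv hb) ha
  have h2 := (uniform_absorption _ _ hr).1 h1
  have h3 := congrArg (· * ((a : H) * ((b : H)⁻¹ * b'))) h2
  simp only [oplus_mul] at h3
  have e1 : (a : H)⁻¹ * b * (a * ((b : H)⁻¹ * b')) = b' := by field_simp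
  have e2 : ((b : H)⁻¹ * b')⁻¹ * ((a : H)⁻¹ * a') * (a * ((b : H)⁻¹ * b')) = a' := by field_simp
  rw [e1, e2, oplus_comm] at h3
  exact h3

/-- The order of the value group: `[a] < [b]` means `a ⊕ b = a`. -/
instance : LT (ValueGroup H) where
  lt x y := ∃ a b : Hˣ, toValueGroup a = x ∧ toValueGroup b = y ∧ (a : H) ⊕ᵣ b = a

theorem toValueGroup_lt_iff (a b : Hˣ) :
    toValueGroup a < toValueGroup b ↔ (a : H) ⊕ᵣ b = a :=
  ⟨fun ⟨_, _, hx, hy, h⟩ => absorbs_congr hx hy h, fun h => ⟨a, b, rfl, rfl, h⟩⟩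

theorem valueGroup_lt_irrefl (x : ValueGroup H) : ¬ x < x := by
  obtain ⟨a, rfl⟩ := toValueGroup_surjective x
  rw [toValueGroup_lt_iff, oplus_eq_left_iff, inv_mul_cancel₀ a.ne_zero]
  exact one_oplus_one

theorem valueGroup_lt_trans (x y z : ValueGroup H) (hxy : x < y) (hyz : y < z) : x < z := by
  obtain ⟨a, rfl⟩ := toValueGroup_surjective x
  obtain ⟨b, rfl⟩ := toValueGroup_surjective y
  obtain ⟨c, rfl⟩ := toValueGroup_surjective z
  rw [toValueGroup_lt_iff] at *
  have h : ((a : H) ⊕ᵣ (b : H)) ⊕ᵣ (c : H) = (a : H) ⊕ᵣ ((b : H) ⊕ᵣ (c : H)) := by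
    by_contra hne
    rcases oplus_half_assoc _ _ _ hne with h | h
    · exact a.ne_zero (hxy.symm.trans h)
    · exact b.ne_zero (hyz.symm.trans h)
  rwa [hxy, hyz, hxy] at h

theorem valueGroup_lt_trichotomy (x y : ValueGroup H) : x < y ∨ x = y ∨ y < x := by
  obtain ⟨a, rfl⟩ := toValueGroup_surjective x
  obtain ⟨b, rfl⟩ := toValueGroup_surjective y
  by_cases h : ResUnit ((a : H)⁻¹ * b)
  · exact Or.inr (Or.inl ((toValueGroup_eq_iff a b).2 h))
  · rw [toValueGroup_lt_iff, toValueGroup_lt_iff, oplus_eq_left_iff, oplus_eq_left_iff]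
    rw [resUnit_iff] at h
    have h0 : (a : H)⁻¹ * b ≠ 0 := mul_ne_zero (inv_ne_zero a.ne_zero) b.ne_zero
    have e : ((a : H)⁻¹ * b)⁻¹ = (b : H)⁻¹ * a := by rw [mul_inv_rev, inv_inv]
    rw [e] at h
    tauto

open Classical in
noncomputable instance : LinearOrder (ValueGroup H) where
  le x y := x < y ∨ x = y
  lt := (· < ·)
  le_refl x := Or.inr rfl
  le_trans x y z := by
    rintro (h | rfl) (h' | rfl)
    · exact Or.inl (valueGroup_lt_trans _ _ _ h h')
    · exact Or.inl h
    · exact Or.inl h'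
    · exact Or.inr rfl
  lt_iff_le_not_ge x y := by
    constructor
    · intro h
      refine ⟨Or.inl h, ?_⟩
      rintro (h' | rfl)
      · exact valueGroup_lt_irrefl _ (valueGroup_lt_trans _ _ _ h h')
      · exact valueGroup_lt_irrefl _ h
    · rintro ⟨h | rfl, h'⟩
      · exact h
      · exact absurd (Or.inr rfl) h'
  le_antisymm x y := by
    rintro (h | rfl) (h' | h')
    · exact absurd (valueGroup_lt_trans _ _ _ h h') (valueGroup_lt_irrefl _)
    · exact h'.symm
    · rfl
    · rfl
  le_total x y := by
    rcases valueGroup_lt_trichotomy x y with h | h | h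
    · exact Or.inl (Or.inl h)
    · exact Or.inl (Or.inr h)
    · exact Or.inr (Or.inl h)
  toDecidableLE := Classical.decRel _

theorem valueGroup_add_lt_add_left (x y z : ValueGroup H) (h : x < y) : z + x < z + y := by
  obtain ⟨a, rfl⟩ := toValueGroup_surjective x
  obtain ⟨b, rfl⟩ := toValueGroup_surjective y
  obtain ⟨c, rfl⟩ := toValueGroup_surjective z
  rw [← toValueGroup_mul, ← toValueGroup_mul, toValueGroup_lt_iff, Units.val_mul, Units.val_mul,
    ← mul_oplus, (toValueGroup_lt_iff a b).1 h]

instance : IsOrderedAddMonoid (ValueGroup H) where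
  add_le_add_left x y h z := by
    rw [add_comm x, add_comm y]
    rcases h.lt_or_eq with h | rfl
    · exact (valueGroup_add_lt_add_left x y z h).le
    · exact le_rfl

open Classical in
/-- The valuation of an RV-sort, with `val 0 = ∞`. -/
noncomputable def val (a : H) : WithTop (ValueGroup H) :=
  if h : a = 0 then ⊤ else (toValueGroup (Units.mk0 a h) : ValueGroup H)

theorem val_zero : val (0 : H) = ⊤ := by simp [val]

theorem val_eq_top_iff {a : H} : val a = ⊤ ↔ a = 0 := by
  by_cases h : a = 0 <;> simp [val, h]

theorem val_unit (a : Hˣ) : val (a : H) = (toValueGroup a : ValueGroup H) := by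
  simp [val]

theorem val_one : val (1 : H) = 0 := by
  have := val_unit (1 : Hˣ)
  rwa [Units.val_one] at this

theorem val_mul (a b : H) : val (a * b) = val a + val b := by
  by_cases ha : a = 0
  · simp [ha, val_zero]
  by_cases hb : b = 0
  · simp [hb, val_zero]
  have := val_unit (Units.mk0 a ha * Units.mk0 b hb)
  rw [toValueGroup_mul, WithTop.coe_add, ← val_unit, ← val_unit] at this
  simpa using this

/-- The hyperaddition of an RV-sort: `a ⊞ b = {x | x = 0 or val x > val a}` if `b` is the additive
inverse of `a`, and `a ⊞ b = {a ⊕ b}` otherwise. -/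
def hyperadd (a b : H) : Set H :=
  {x | (a ⊕ᵣ b = 0 ∧ (x = 0 ∨ val a < val x)) ∨ (a ⊕ᵣ b ≠ 0 ∧ x = a ⊕ᵣ b)}

variable (H) in
/-- The elements of `H` whose value is `γ` or `∞`. -/
@[ext]
structure Fiber (γ : ValueGroup H) where
  elt : H
  val_elt : val elt = γ ∨ val elt = ⊤

theorem fiber_scale {γ : ValueGroup H} (u : Hˣ) (hu : toValueGroup u = γ) {a : H}
    (ha : val a = γ ∨ val a = ⊤) : ∃ r : H, (r = 0 ∨ ResUnit r) ∧ a = u * r := by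
  refine ⟨(u : H)⁻¹ * a, ?_, by rw [mul_inv_cancel_left₀ u.ne_zero]⟩
  by_cases h0 : a = 0
  · left; simp [h0]
  right
  have h := ha.resolve_right (mt val_eq_top_iff.1 h0)
  rw [← hu, ← Units.val_mk0 h0, val_unit, WithTop.coe_inj] at h
  simpa using (toValueGroup_eq_iff _ _).1 h.symm

theorem val_unit_mul_resUnit {γ : ValueGroup H} (u : Hˣ) (hu : toValueGroup u = γ) {r : H}
    (hr : r = 0 ∨ ResUnit r) : val (u * r : H) = γ ∨ val (u * r : H) = ⊤ := by
  rcases hr with rfl | hr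
  · right; simp [val_zero]
  left
  have := (toValueGroup_eq_iff u (u * Units.mk0 r hr.1)).2 (by
    simpa using hr)
  have h2 := val_unit (u * Units.mk0 r hr.1)
  rw [← this, hu] at h2
  simpa using h2

theorem val_oplus_mem {γ : ValueGroup H} {a b : H} (ha : val a = γ ∨ val a = ⊤)
    (hb : val b = γ ∨ val b = ⊤) : val (a ⊕ᵣ b) = γ ∨ val (a ⊕ᵣ b) = ⊤ := by
  obtain ⟨u, hu⟩ := toValueGroup_surjective γ
  obtain ⟨r, hr, rfl⟩ := fiber_scale u hu ha
  obtain ⟨s, hs, rfl⟩ := fiber_scale u hu hb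
  rw [← mul_oplus]
  apply val_unit_mul_resUnit u hu
  rcases hr with rfl | hr
  · rwa [zero_oplus]
  rcases hs with rfl | hs
  · rw [oplus_zero]; exact Or.inr hr
  · exact resUnit_oplus hr hs

theorem fiber_oplus_assoc {γ : ValueGroup H} {a b c : H} (ha : val a = γ ∨ val a = ⊤)
    (hb : val b = γ ∨ val b = ⊤) (hc : val c = γ ∨ val c = ⊤) :
    (a ⊕ᵣ b) ⊕ᵣ c = a ⊕ᵣ (b ⊕ᵣ c) := by
  obtain ⟨u, hu⟩ := toValueGroup_surjective γ
  obtain ⟨r, hr, rfl⟩ := fiber_scale u hu ha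
  obtain ⟨s, hs, rfl⟩ := fiber_scale u hu hb
  obtain ⟨t, ht, rfl⟩ := fiber_scale u hu hc
  simp only [← mul_oplus]
  congr 1
  rcases hr with rfl | hr
  · simp only [zero_oplus]
  rcases hs with rfl | hs
  · simp only [zero_oplus, oplus_zero]
  rcases ht with rfl | ht
  · simp only [oplus_zero]
  exact resUnit_oplus_assoc hr hs ht

/-- On elements of value `γ` or `∞`, the operation `⊕` is associative and commutative, so that
finite sums make sense. -/
instance instAddCommMonoidFiber (γ : ValueGroup H) : AddCommMonoid (Fiber H γ) :=
  letI : Add (Fiber H γ) := ⟨fun a b => ⟨a.1 ⊕ᵣ b.1, val_oplus_mem a.2 b.2⟩⟩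
  letI : Zero (Fiber H γ) := ⟨⟨0, Or.inr val_zero⟩⟩
  { add := (· + ·)
    zero := 0
    nsmul := nsmulRec
    add_assoc a b c := Fiber.ext (fiber_oplus_assoc a.2 b.2 c.2)
    zero_add a := Fiber.ext (zero_oplus a.1)
    add_zero a := Fiber.ext (oplus_zero a.1)
    add_comm a b := Fiber.ext (oplus_comm a.1 b.1) }

end RVSort

open RVSort in
/-- The underlying set of the Hahn field of an RV-sort: families `(a_γ)` with
`val a_γ ∈ {γ, ∞}` and with well-ordered support. -/
@[ext]
structure HahnField (H : Type*) [RVSort H] where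
  coeff : ValueGroup H → H
  val_coeff : ∀ γ, val (coeff γ) = γ ∨ val (coeff γ) = ⊤
  isWF_support : {γ | coeff γ ≠ 0}.IsWF

namespace HahnField

open RVSort

variable {H : Type*} [RVSort H]

/-- The set of all `γ` with `a_γ ≠ 0`. -/
def support (a : HahnField H) : Set (ValueGroup H) := {γ | a.coeff γ ≠ 0}

/-- The family that is constantly `0`. -/
def zero : HahnField H where
  coeff _ := 0
  val_coeff _ := Or.inr val_zero
  isWF_support := by simp

open Classical in
/-- The family with `a_0 = 1` and `a_γ = 0` for `γ ≠ 0`. -/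
noncomputable def one : HahnField H where
  coeff γ := if γ = 0 then 1 else 0
  val_coeff γ := by
    by_cases h : γ = 0
    · left; simp [h, val_one]
    · right; simp [h, val_zero]
  isWF_support := (Set.finite_singleton (0 : ValueGroup H)).isWF.mono (fun γ hγ => by
    by_contra h
    exact hγ (if_neg h))

/-- Componentwise addition. -/
def add (a b : HahnField H) : HahnField H where
  coeff γ := a.coeff γ ⊕ᵣ b.coeff γ
  val_coeff γ := val_oplus_mem (a.val_coeff γ) (b.val_coeff γ)
  isWF_support := (a.isWF_support.union b.isWF_support).mono (fun γ hγ => by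
    by_contra h
    simp only [Set.mem_union, Set.mem_ofPred_eq, not_or, not_not] at h
    exact hγ (by rw [h.1, h.2, zero_oplus]))

/-- The finite set of pairs `(δ, ε)` with `δ` in the support of `a`, `ε` in the support of `b`, and
`δ + ε = γ`. -/
noncomputable def pairs (a b : HahnField H) (γ : ValueGroup H) :
    Finset (ValueGroup H × ValueGroup H) :=
  (Set.AddAntidiagonal.finite_of_isPWO a.isWF_support.isPWO b.isWF_support.isPWO γ).toFinset

theorem mem_pairs {a b : HahnField H} {γ : ValueGroup H} {p : ValueGroup H × ValueGroup H} :
    p ∈ pairs a b γ ↔ p.1 ∈ a.support ∧ p.2 ∈ b.support ∧ p.1 + p.2 = γ := by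
  simp [pairs, support]

theorem val_coeff_mul_coeff (a b : HahnField H) {γ δ ε : ValueGroup H} (h : δ + ε = γ) :
    val (a.coeff δ * b.coeff ε) = γ ∨ val (a.coeff δ * b.coeff ε) = ⊤ := by
  rw [val_mul]
  rcases a.val_coeff δ with h1 | h1
  · rcases b.val_coeff ε with h2 | h2
    · left; rw [h1, h2, ← h, WithTop.coe_add]
    · right; rw [h2, add_top]
  · right; rw [h1, top_add]

/-- Convolution product: `(a · b)_γ` is the finite `⊕`-sum of all products `a_δ · b_ε` with
`δ + ε = γ`. It suffices to sum over the `δ` and `ε` in the supports, the other products being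
zero. -/
noncomputable def mul (a b : HahnField H) : HahnField H where
  coeff γ := (∑ p ∈ (pairs a b γ).attach,
    (⟨a.coeff p.1.1 * b.coeff p.1.2, val_coeff_mul_coeff a b (mem_pairs.1 p.2).2.2⟩ :
      Fiber H γ)).1
  val_coeff γ := (∑ p ∈ (pairs a b γ).attach,
    (⟨a.coeff p.1.1 * b.coeff p.1.2, val_coeff_mul_coeff a b (mem_pairs.1 p.2).2.2⟩ :
      Fiber H γ)).2
  isWF_support := (a.isWF_support.add b.isWF_support).mono (fun γ hγ => by
    by_contra h
    apply hγ
    have he : pairs a b γ = ∅ := by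
      refine Finset.eq_empty_of_forall_notMem fun p hp => h ?_
      obtain ⟨h1, h2, h3⟩ := mem_pairs.1 hp
      exact Set.mem_add.2 ⟨p.1, h1, p.2, h2, h3⟩
    rw [Finset.sum_eq_zero fun p _ => absurd p.2 (by simp [he])]
    rfl)

open Classical in
/-- The valuation: the minimum of the support, and `∞` for the zero family. -/
noncomputable def val (a : HahnField H) : WithTop (ValueGroup H) :=
  if h : a.support.Nonempty then (a.isWF_support.min h : ValueGroup H) else ⊤

end HahnField

namespace ValuedHyperfield

variable {K Γ : Type*} [Field K] [AddCommGroup Γ] [LinearOrder Γ] [IsOrderedAddMonoid Γ]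

/-- The subgroup `1 + 𝔪_ρ` of `Kˣ`, where `𝔪_ρ = {x | v x > r for all r ∈ ρ}`. The set `ρ` is meant
to be a nonempty initial segment of the nonnegative elements of `Γ`; only `0 ∈ ρ` matters here. -/
def oneAddIdeal (v : AddValuation K (WithTop Γ)) (ρ : Set Γ) (h0 : 0 ∈ ρ) : Subgroup Kˣ where
  carrier := {u | ∀ r ∈ ρ, (r : WithTop Γ) < v ((u : K) - 1)}
  mul_mem' {a b} ha hb r hr := by
    have hb0 : v (b : K) = 0 := by
      have h := v.map_add_eq_of_lt_left (x := 1) (y := (b : K) - 1)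
        (by rw [v.map_one]; exact hb 0 h0)
      simpa using h
    have e : ((a * b : Kˣ) : K) - 1 = ((a : K) - 1) * b + (b - 1) := by push_cast; ring
    rw [e]
    refine v.map_lt_add ?_ (hb r hr)
    rw [v.map_mul, hb0, add_zero]
    exact ha r hr
  one_mem' r _ := by simp
  inv_mem' {a} ha r hr := by
    have ha0 : v (a : K) = 0 := by
      have h := v.map_add_eq_of_lt_left (x := 1) (y := (a : K) - 1)
        (by rw [v.map_one]; exact ha 0 h0)
      simpa using h
    have e : (a : K) - 1 = a * (1 - ((a⁻¹ : Kˣ) : K)) := by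
      rw [mul_sub, mul_one, Units.mul_inv]
    have h := ha r hr
    rw [e, v.map_mul, ha0, zero_add, v.map_sub_swap] at h
    exact h

/-- The set of the factor hyperfield `K_T`: the cosets of `T` in `Kˣ` together with `[0]`, with the
obvious multiplication. -/
abbrev Factor (T : Subgroup Kˣ) : Type _ := WithZero (Kˣ ⧸ T)

open Classical in
/-- The class `[x]` of `x` in the factor hyperfield. -/
noncomputable def cls (T : Subgroup Kˣ) (x : K) : Factor T :=
  if h : x = 0 then 0 else ((Units.mk0 x h : Kˣ ⧸ T) : WithZero (Kˣ ⧸ T))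

/-- The hyperaddition of the factor hyperfield: `[x] + [y] = {[x + y t] | t ∈ T}`. -/
def factorHyperadd (T : Subgroup Kˣ) (X Y : Factor T) : Set (Factor T) :=
  {Z | ∃ x y : K, cls T x = X ∧ cls T y = Y ∧ ∃ t ∈ T, Z = cls T (x + y * t)}

end ValuedHyperfield

/-! ### Negation and absorption in an RV-sort; the graded ring of its fibers. -/

namespace RVSort

variable {H : Type*} [RVSort H]

/-! The fibers of the valuation on `H` are commutative groups under `⊕`, and `·` multiplies them
compatibly with addition in `Γ`. Their direct sum is therefore a graded ring, and a family `(a_γ)`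
is a Hahn series over this ring whose coefficient at `γ` is homogeneous of degree `γ`. The ring laws
and the lower bounds for the valuation are inherited from Hahn series along this injection
(`toHahnSeries`). The valuation is multiplicative because lowest coefficients are nonzero elements
of `H`, and products of these are nonzero.

Inverses and henselianity come from spherical completeness: families that agree on growing initial
segments of `Γ` glue to one family, so a strictly contracting self-map of an open ball has a fixed
point (`exists_fixedPoint`). This is applied to `x ↦ x - (b x - 1)` and to a Newton map with
constant slope.

The isomorphism is induced by the leading coefficient `lead`. It is multiplicative and surjective,
with kernel `1 + 𝔪` on units. Sums of families with leading coefficients `a`, `b` have leading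
coefficients exactly in `a ⊞ b` (`lead_add_mem_hyperadd`, `exists_lead_add_eq`). -/

variable (H) in
theorem exists_one_oplus_eq_zero : ∃ m : H, (1 : H) ⊕ᵣ m = 0 ∧ val m = 0 := by
  obtain ⟨_, ha, -, h0, h1⟩ := resField_isField (H := H)
  have e : (1 : H) ⊕ᵣ (-1 : ResField H).1 = 0 := by
    rw [← h1, ← ha, add_neg_cancel, h0]
  have hu : ResUnit (-1 : ResField H).1 := (-1 : ResField H).2.resolve_left fun h => by
    rw [h, oplus_zero] at e
    exact rv_one_ne_zero e
  refine ⟨_, e, ?_⟩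
  have h := val_unit_mul_resUnit (γ := 0) (1 : Hˣ) rfl (Or.inr hu)
  rw [Units.val_one, one_mul] at h
  exact h.resolve_right (mt val_eq_top_iff.1 hu.1)

variable (H) in
/-- The additive inverse of `1`. -/
noncomputable def negOne : H := (exists_one_oplus_eq_zero H).choose

theorem one_oplus_negOne : (1 : H) ⊕ᵣ negOne H = 0 := (exists_one_oplus_eq_zero H).choose_spec.1

theorem val_negOne : val (negOne H) = 0 := (exists_one_oplus_eq_zero H).choose_spec.2

theorem oplus_negOne_mul (a : H) : a ⊕ᵣ negOne H * a = 0 := by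
  conv_lhs => rw [← one_mul a, ← mul_assoc, mul_one, ← oplus_mul, one_oplus_negOne, zero_mul]

theorem val_negOne_mul (a : H) : val (negOne H * a) = val a := by
  rw [val_mul, val_negOne, zero_add]

theorem oplus_eq_left_of_val_lt {a b : H} (h : val a < val b) : a ⊕ᵣ b = a := by
  by_cases ha : a = 0
  · simp [ha, val_zero] at h
  by_cases hb : b = 0
  · rw [hb, oplus_zero]
  have := toValueGroup_lt_iff (Units.mk0 a ha) (Units.mk0 b hb)
  rw [← WithTop.coe_lt_coe, ← val_unit, ← val_unit] at this
  exact this.1 h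

/-- If the values differed, the sum would be the summand of smaller value; that summand would then
be `0`, whose value `⊤` is never the smaller one. -/
theorem val_eq_of_oplus_eq_zero {a b : H} (h : a ⊕ᵣ b = 0) : val a = val b := by
  rcases lt_trichotomy (val a) (val b) with hl | he | hl
  · have := oplus_eq_left_of_val_lt hl
    rw [h] at this
    simp [← this, val_zero] at hl
  · exact he
  · have := oplus_eq_left_of_val_lt hl
    rw [oplus_comm, h] at this
    simp [← this, val_zero] at hl

namespace Fiber

instance : GradedMonoid.GMul (Fiber H) where
  mul {γ δ} a b := ⟨a.elt * b.elt, by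
    rw [val_mul]
    rcases a.val_elt with h | h <;> rcases b.val_elt with h' | h' <;> simp [h, h']⟩

instance : GradedMonoid.GOne (Fiber H) where
  one := ⟨1, Or.inl val_one⟩

/-- Homogeneous elements of equal but not syntactically equal degrees can be compared in `H`, so the
graded laws reduce to laws of `H`. -/
theorem gradedMonoid_mk_eq {γ δ : ValueGroup H} {a : Fiber H γ} {b : Fiber H δ} (h : γ = δ)
    (hab : a.elt = b.elt) : GradedMonoid.mk γ a = GradedMonoid.mk δ b := by
  subst h
  rw [Fiber.ext hab]

/-- The fibers of the valuation form a graded commutative semiring. -/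
noncomputable instance : DirectSum.GCommSemiring (Fiber H) where
  mul_zero _ := Fiber.ext (mul_zero _)
  zero_mul _ := Fiber.ext (zero_mul _)
  mul_add _ _ _ := Fiber.ext (mul_oplus _ _ _)
  add_mul _ _ _ := Fiber.ext (oplus_mul _ _ _)
  one_mul _ := gradedMonoid_mk_eq (zero_add _) (one_mul _)
  mul_one _ := gradedMonoid_mk_eq (add_zero _) (mul_one _)
  mul_assoc _ _ _ := gradedMonoid_mk_eq (add_assoc _ _ _) (mul_assoc _ _ _)
  mul_comm _ _ := gradedMonoid_mk_eq (add_comm _ _) (mul_comm _ _)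
  natCast n := n • GradedMonoid.GOne.one
  natCast_zero := zero_nsmul _
  natCast_succ n := succ_nsmul _ n

end Fiber

variable (H) in
/-- The graded ring attached to an RV-sort. -/
abbrev GradedRing : Type _ := DirectSum (ValueGroup H) (Fiber H)

end RVSort

/-! ### The ring of families, embedded in Hahn series over the graded ring. -/

namespace HahnField

open RVSort

variable {H : Type*} [RVSort H]

/-- The coefficient `a_γ` as an element of the fiber over `γ`. -/
def fiberCoeff (a : HahnField H) (γ : ValueGroup H) : Fiber H γ := ⟨a.coeff γ, a.val_coeff γ⟩

theorem of_fiberCoeff_eq_zero {a : HahnField H} {γ : ValueGroup H} :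
    DirectSum.of (Fiber H) γ (a.fiberCoeff γ) = 0 ↔ a.coeff γ = 0 := by
  rw [← map_zero (DirectSum.of (Fiber H) γ), (DirectSum.of_injective γ).eq_iff, Fiber.ext_iff]
  rfl

theorem support_of_fiberCoeff (a : HahnField H) :
    (Function.support fun γ => DirectSum.of (Fiber H) γ (a.fiberCoeff γ)) = a.support := by
  ext γ
  simp only [Function.mem_support, ne_eq, of_fiberCoeff_eq_zero]
  rfl

/-- A family as a Hahn series over the graded ring of the RV-sort. -/
noncomputable def toHahnSeries (a : HahnField H) : HahnSeries (ValueGroup H) (GradedRing H) where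
  coeff γ := DirectSum.of (Fiber H) γ (a.fiberCoeff γ)
  isPWO_support' := by
    rw [support_of_fiberCoeff]
    exact a.isWF_support.isPWO

theorem coeff_toHahnSeries (a : HahnField H) (γ : ValueGroup H) :
    a.toHahnSeries.coeff γ = DirectSum.of (Fiber H) γ (a.fiberCoeff γ) := rfl

theorem support_toHahnSeries (a : HahnField H) : a.toHahnSeries.support = a.support :=
  support_of_fiberCoeff a

theorem toHahnSeries_injective : Function.Injective (toHahnSeries (H := H)) := fun a b h => by
  ext γ
  have := congrArg (fun x => x.coeff γ) h
  exact congrArg Fiber.elt (DirectSum.of_injective γ this)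

noncomputable scoped instance : Zero (HahnField H) := ⟨zero⟩

noncomputable scoped instance : One (HahnField H) := ⟨one⟩

noncomputable scoped instance : Add (HahnField H) := ⟨add⟩

noncomputable scoped instance : Mul (HahnField H) := ⟨mul⟩

/-- Multiplication of all entries by the additive inverse of `1`. -/
noncomputable scoped instance : Neg (HahnField H) where
  neg a :=
    { coeff γ := negOne H * a.coeff γ
      val_coeff γ := by simpa only [val_negOne_mul] using a.val_coeff γ
      isWF_support := a.isWF_support.mono fun γ hγ => right_ne_zero_of_mul hγ }

@[simp] theorem coeff_add (a b : HahnField H) (γ : ValueGroup H) :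
    (a + b).coeff γ = a.coeff γ ⊕ᵣ b.coeff γ := rfl

@[simp] theorem coeff_neg (a : HahnField H) (γ : ValueGroup H) :
    (-a).coeff γ = negOne H * a.coeff γ := rfl

theorem fiberCoeff_mul (a b : HahnField H) (γ : ValueGroup H) :
    (a * b).fiberCoeff γ = ∑ p ∈ (pairs a b γ).attach,
      (⟨a.coeff p.1.1 * b.coeff p.1.2, val_coeff_mul_coeff a b (mem_pairs.1 p.2).2.2⟩ :
        Fiber H γ) := rfl

theorem toHahnSeries_zero : toHahnSeries (0 : HahnField H) = 0 := by
  ext1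
  funext γ
  exact of_fiberCoeff_eq_zero.2 rfl

theorem toHahnSeries_one : toHahnSeries (1 : HahnField H) = 1 := by
  ext1
  funext γ
  rw [coeff_toHahnSeries, HahnSeries.coeff_one]
  split_ifs with h
  · subst h
    rw [DirectSum.one_def]
    congr 1
    exact Fiber.ext (if_pos rfl)
  · exact of_fiberCoeff_eq_zero.2 (if_neg h)

theorem toHahnSeries_add (a b : HahnField H) :
    toHahnSeries (a + b) = toHahnSeries a + toHahnSeries b := by
  ext1
  funext γ
  exact map_add (DirectSum.of (Fiber H) γ) (a.fiberCoeff γ) (b.fiberCoeff γ)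

theorem toHahnSeries_mul (a b : HahnField H) :
    toHahnSeries (a * b) = toHahnSeries a * toHahnSeries b := by
  ext1
  funext γ
  rw [coeff_toHahnSeries, fiberCoeff_mul, map_sum, HahnSeries.coeff_mul]
  -- The supports agree, so both convolutions run over the same pairs.
  have hs : Finset.antidiagonal a.toHahnSeries.isPWO_support b.toHahnSeries.isPWO_support γ
      = pairs a b γ := by
    ext p
    rw [mem_pairs, Finset.mem_antidiagonal, support_toHahnSeries, support_toHahnSeries]
  rw [hs, ← Finset.sum_attach (pairs a b γ)]
  refine Finset.sum_congr rfl fun p _ => ?_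
  rw [coeff_toHahnSeries, coeff_toHahnSeries, DirectSum.of_mul_of]
  apply DirectSum.of_eq_of_gradedMonoid_eq
  exact Fiber.gradedMonoid_mk_eq (mem_pairs.1 p.2).2.2.symm rfl

-- All laws are pulled back along `toHahnSeries`, except negation: the graded ring carries only a
-- semiring structure here, so that law is checked on coefficients.
noncomputable scoped instance : CommRing (HahnField H) where
  add_assoc a b c := toHahnSeries_injective (by simp only [toHahnSeries_add, add_assoc])
  zero_add a := toHahnSeries_injective (by simp only [toHahnSeries_add, toHahnSeries_zero, zero_add])
  add_zero a := toHahnSeries_injective (by simp only [toHahnSeries_add, toHahnSeries_zero, add_zero])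
  add_comm a b := toHahnSeries_injective (by simp only [toHahnSeries_add, add_comm])
  neg_add_cancel a := by
    ext γ
    exact (oplus_comm _ _).trans (oplus_negOne_mul _)
  mul_assoc a b c := toHahnSeries_injective (by simp only [toHahnSeries_mul, mul_assoc])
  mul_comm a b := toHahnSeries_injective (by simp only [toHahnSeries_mul, mul_comm])
  one_mul a := toHahnSeries_injective (by simp only [toHahnSeries_mul, toHahnSeries_one, one_mul])
  mul_one a := toHahnSeries_injective (by simp only [toHahnSeries_mul, toHahnSeries_one, mul_one])
  zero_mul a := toHahnSeries_injective
    (by simp only [toHahnSeries_mul, toHahnSeries_zero, zero_mul])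
  mul_zero a := toHahnSeries_injective
    (by simp only [toHahnSeries_mul, toHahnSeries_zero, mul_zero])
  left_distrib a b c := toHahnSeries_injective
    (by simp only [toHahnSeries_mul, toHahnSeries_add, mul_add])
  right_distrib a b c := toHahnSeries_injective
    (by simp only [toHahnSeries_mul, toHahnSeries_add, add_mul])
  nsmul := nsmulRec
  zsmul := zsmulRec

end HahnField

/-! ### Valuation and leading coefficients. -/

namespace HahnField

open RVSort

variable {H : Type*} [RVSort H]

theorem val_eq_orderTop (a : HahnField H) : val a = a.toHahnSeries.orderTop := by
  by_cases h : a.support.Nonempty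
  · have hm := a.isWF_support.min_mem h
    rw [val, dif_pos h, eq_comm]
    refine HahnSeries.orderTop_eq_of_le ?_ fun γ hγ => ?_
    · rwa [support_toHahnSeries]
    · rw [support_toHahnSeries] at hγ
      exact a.isWF_support.min_le h hγ
  · rw [val, dif_neg h, eq_comm, HahnSeries.orderTop_eq_top, ← HahnSeries.support_eq_empty_iff,
      support_toHahnSeries]
    exact Set.not_nonempty_iff_eq_empty.1 h

theorem val_eq_top_iff {a : HahnField H} : val a = ⊤ ↔ a = 0 := by
  rw [val_eq_orderTop, HahnSeries.orderTop_eq_top, ← toHahnSeries_zero,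
    toHahnSeries_injective.eq_iff]

theorem val_zero : val (0 : HahnField H) = ⊤ := val_eq_top_iff.2 rfl

theorem coeff_ne_zero_of_val_eq {a : HahnField H} {γ : ValueGroup H} (h : val a = γ) :
    a.coeff γ ≠ 0 := by
  rw [val_eq_orderTop] at h
  exact mt of_fiberCoeff_eq_zero.2 (HahnSeries.coeff_orderTop_ne h)

theorem val_le_of_coeff_ne_zero {a : HahnField H} {γ : ValueGroup H} (h : a.coeff γ ≠ 0) :
    val a ≤ γ := by
  rw [val_eq_orderTop]
  exact HahnSeries.orderTop_le_of_coeff_ne_zero (mt of_fiberCoeff_eq_zero.1 h)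

theorem coeff_eq_zero_of_lt_val {a : HahnField H} {γ : ValueGroup H} (h : γ < val a) :
    a.coeff γ = 0 := by
  by_contra h0
  exact (val_le_of_coeff_ne_zero h0).not_gt h

theorem lt_val_iff {a : HahnField H} {γ : ValueGroup H} :
    γ < val a ↔ ∀ δ ≤ γ, a.coeff δ = 0 := by
  refine ⟨fun h δ hδ => coeff_eq_zero_of_lt_val (lt_of_le_of_lt (mod_cast hδ) h), fun h => ?_⟩
  induction hv : val a with
  | top => exact WithTop.coe_lt_top _
  | coe δ =>
    by_contra hle
    exact coeff_ne_zero_of_val_eq hv (h δ (WithTop.coe_le_coe.1 (not_lt.1 hle)))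

theorem le_val_iff {a : HahnField H} {γ : ValueGroup H} :
    γ ≤ val a ↔ ∀ δ < γ, a.coeff δ = 0 := by
  refine ⟨fun h δ hδ => coeff_eq_zero_of_lt_val (lt_of_lt_of_le (mod_cast hδ) h), fun h => ?_⟩
  induction hv : val a with
  | top => exact le_top
  | coe δ =>
    by_contra hlt
    exact coeff_ne_zero_of_val_eq hv (h δ (WithTop.coe_lt_coe.1 (not_le.1 hlt)))

theorem coeff_eq_zero_of_val_eq {a : HahnField H} {γ δ : ValueGroup H} (h : val a = γ)
    (hδ : δ < γ) : a.coeff δ = 0 :=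
  coeff_eq_zero_of_lt_val (by rw [h]; exact mod_cast hδ)

theorem val_eq_of_coeff {a : HahnField H} {γ : ValueGroup H} (h0 : a.coeff γ ≠ 0)
    (h : ∀ δ < γ, a.coeff δ = 0) : val a = γ :=
  le_antisymm (val_le_of_coeff_ne_zero h0) (le_val_iff.2 h)

/-- At the lowest exponent only the pair `(γ, δ)` contributes, so nothing can cancel. -/
theorem coeff_mul_add {a b : HahnField H} {γ δ : ValueGroup H} (ha : val a = γ) (hb : val b = δ) :
    (a * b).coeff (γ + δ) = a.coeff γ * b.coeff δ := by
  have order_eq : ∀ {c : HahnField H} {ε : ValueGroup H}, val c = ε →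
      c.toHahnSeries.order = ε := fun {c ε} hc => by
    rw [val_eq_orderTop] at hc
    have h0 : c.toHahnSeries ≠ 0 := HahnSeries.orderTop_ne_top.1 (by simp [hc])
    rw [← HahnSeries.order_eq_orderTop_of_ne_zero h0] at hc
    exact mod_cast hc
  have h := HahnSeries.coeff_mul_order_add_order a.toHahnSeries b.toHahnSeries
  rw [HahnSeries.leadingCoeff_eq, HahnSeries.leadingCoeff_eq, order_eq ha, order_eq hb,
    ← toHahnSeries_mul, coeff_toHahnSeries, coeff_toHahnSeries, coeff_toHahnSeries,
    DirectSum.of_mul_of] at h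
  exact congrArg Fiber.elt (DirectSum.of_injective _ h)

/-- The graded ring need not be known to be a domain: it suffices that the two lowest coefficients
are homogeneous, because their product is then nonzero already in `H`. -/
theorem val_mul (a b : HahnField H) : val (a * b) = val a + val b := by
  induction ha : val a with
  | top => rw [val_eq_top_iff.1 ha, zero_mul, val_zero, top_add]
  | coe γ =>
    induction hb : val b with
    | top => rw [val_eq_top_iff.1 hb, mul_zero, val_zero, add_top]
    | coe δ =>
      apply le_antisymm
      · rw [← WithTop.coe_add]
        apply val_le_of_coeff_ne_zero
        rw [coeff_mul_add ha hb]
        exact mul_ne_zero (coeff_ne_zero_of_val_eq ha) (coeff_ne_zero_of_val_eq hb)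
      · rw [← ha, ← hb, val_eq_orderTop, val_eq_orderTop, val_eq_orderTop, toHahnSeries_mul]
        exact HahnSeries.orderTop_add_le_mul

open Classical in
/-- The family with entry `a` at `val a` and zero elsewhere. -/
noncomputable def monomial (a : H) : HahnField H where
  coeff γ := if RVSort.val a = γ then a else 0
  val_coeff γ := by
    split_ifs with h
    · exact Or.inl h
    · exact Or.inr RVSort.val_zero
  isWF_support := (show Set.Subsingleton _ from fun γ hγ δ hδ => by
    have h1 : RVSort.val a = γ := by_contra fun h => hγ (if_neg h)
    have h2 : RVSort.val a = δ := by_contra fun h => hδ (if_neg h)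
    exact WithTop.coe_injective (h1.symm.trans h2)).finite.isWF

theorem coeff_monomial_of_eq {a : H} {γ : ValueGroup H} (h : RVSort.val a = γ) :
    (monomial a).coeff γ = a := if_pos h

theorem coeff_monomial_of_ne {a : H} {γ : ValueGroup H} (h : RVSort.val a ≠ γ) :
    (monomial a).coeff γ = 0 := if_neg h

theorem monomial_zero : monomial (0 : H) = 0 := by
  ext γ
  exact coeff_monomial_of_ne (by simp [RVSort.val_zero])

theorem monomial_one : monomial (1 : H) = 1 := by
  ext γ
  have : RVSort.val (1 : H) = γ ↔ γ = 0 := by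
    rw [val_one, ← WithTop.coe_zero, WithTop.coe_inj, eq_comm]
  exact if_congr this rfl rfl

theorem monomial_add_of_oplus_eq_zero {a b : H} (h : a ⊕ᵣ b = 0) :
    monomial a + monomial b = 0 := by
  have hv := val_eq_of_oplus_eq_zero h
  ext γ
  rw [coeff_add]
  by_cases hγ : RVSort.val a = γ
  · rw [coeff_monomial_of_eq hγ, coeff_monomial_of_eq (hv.symm.trans hγ), h]
    rfl
  · rw [coeff_monomial_of_ne hγ, coeff_monomial_of_ne (hv ▸ hγ), zero_oplus]
    rfl

theorem val_monomial (a : H) : val (monomial a) = RVSort.val a := by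
  induction ha : RVSort.val a with
  | top => rw [RVSort.val_eq_top_iff.1 ha, monomial_zero, val_zero]
  | coe γ =>
    refine val_eq_of_coeff ?_ fun δ hδ => coeff_monomial_of_ne ?_
    · rw [coeff_monomial_of_eq ha]
      intro h
      simp [h, RVSort.val_zero] at ha
    · rw [ha]
      exact mod_cast hδ.ne'

theorem val_hahn_one : val (1 : HahnField H) = 0 := by
  rw [← monomial_one, val_monomial, val_one]

theorem min_val_le_val_add (a b : HahnField H) : min (val a) (val b) ≤ val (a + b) := by
  rw [val_eq_orderTop, val_eq_orderTop, val_eq_orderTop, toHahnSeries_add]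
  exact HahnSeries.min_orderTop_le_orderTop_add

variable (H) in
/-- The valuation of the ring of families. -/
noncomputable def addValuation : AddValuation (HahnField H) (WithTop (ValueGroup H)) :=
  AddValuation.of val val_zero val_hahn_one min_val_le_val_add val_mul

/-- The leading coefficient of a family. -/
noncomputable def lead (a : HahnField H) : H := a.coeff ((val a).untopD 0)

theorem lead_of_val_eq {a : HahnField H} {γ : ValueGroup H} (h : val a = γ) :
    lead a = a.coeff γ := by
  rw [lead, h, WithTop.untopD_coe]

/-- The default exponent `0` in `lead` is harmless, since every coefficient of the zero family
vanishes. -/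
theorem lead_zero : lead (0 : HahnField H) = 0 := rfl

theorem val_lead (a : HahnField H) : RVSort.val (lead a) = val a := by
  induction ha : val a with
  | top => rw [val_eq_top_iff.1 ha, lead_zero, RVSort.val_zero]
  | coe γ =>
    rw [lead_of_val_eq ha]
    exact (a.val_coeff γ).resolve_right (mt RVSort.val_eq_top_iff.1 (coeff_ne_zero_of_val_eq ha))

theorem lead_eq_zero_iff {a : HahnField H} : lead a = 0 ↔ a = 0 := by
  rw [← RVSort.val_eq_top_iff, val_lead, val_eq_top_iff]

theorem lead_mul (a b : HahnField H) : lead (a * b) = lead a * lead b := by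
  induction ha : val a with
  | top => rw [val_eq_top_iff.1 ha, zero_mul, lead_zero, zero_mul]
  | coe γ =>
    induction hb : val b with
    | top => rw [val_eq_top_iff.1 hb, mul_zero, lead_zero, mul_zero]
    | coe δ =>
      rw [lead_of_val_eq ha, lead_of_val_eq hb, ← coeff_mul_add ha hb]
      exact lead_of_val_eq (by rw [val_mul, ha, hb, WithTop.coe_add])

theorem lead_monomial (a : H) : lead (monomial a) = a := by
  induction ha : RVSort.val a with
  | top => rw [RVSort.val_eq_top_iff.1 ha, monomial_zero, lead_zero]
  | coe γ => rw [lead_of_val_eq ((val_monomial a).trans ha), coeff_monomial_of_eq ha]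

theorem lead_one : lead (1 : HahnField H) = 1 := by
  rw [← monomial_one, lead_monomial]

theorem lead_add_of_val_lt {a b : HahnField H} (h : val a < val b) : lead (a + b) = lead a := by
  have hab : val (a + b) = val a := (addValuation H).map_add_eq_of_lt_left h
  induction ha : val a with
  | top => simp [ha] at h
  | coe γ =>
    rw [ha] at h
    rw [lead_of_val_eq ha, lead_of_val_eq (hab.trans ha), coeff_add,
      coeff_eq_zero_of_lt_val h, oplus_zero]

/-- Leading coefficients agree exactly if the difference has larger value. -/
theorem lead_eq_lead_iff {a b : HahnField H} (ha : a ≠ 0) :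
    lead b = lead a ↔ val a < val (b - a) := by
  refine ⟨fun h => ?_, fun h => ?_⟩
  · have hv : val b = val a := by rw [← val_lead, h, val_lead]
    induction hγ : val a with
    | top => exact absurd (val_eq_top_iff.1 hγ) ha
    | coe γ =>
      rw [hγ] at hv
      rw [lead_of_val_eq hγ, lead_of_val_eq hv] at h
      rw [lt_val_iff]
      intro δ hδ
      rw [sub_eq_add_neg, coeff_add, coeff_neg]
      rcases hδ.lt_or_eq with hlt | rfl
      · rw [coeff_eq_zero_of_val_eq hγ hlt,
          coeff_eq_zero_of_val_eq hv hlt, mul_zero, zero_oplus]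
      · rw [h, oplus_negOne_mul]
  · have := lead_add_of_val_lt h
    rwa [add_sub_cancel] at this

/-- The leading coefficients of sums of families with given leading coefficients. -/
theorem lead_add_mem_hyperadd (a b : HahnField H) :
    lead (a + b) ∈ hyperadd (lead a) (lead b) := by
  by_cases h : lead a ⊕ᵣ lead b = 0
  · refine Or.inl ⟨h, ?_⟩
    have hv : val a = val b := by simpa only [val_lead] using val_eq_of_oplus_eq_zero h
    rw [val_lead, val_lead, lead_eq_zero_iff]
    induction ha : val a with
    | top =>
      left
      rw [val_eq_top_iff.1 ha, val_eq_top_iff.1 (hv.symm.trans ha), add_zero]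
    | coe γ =>
      right
      have hb := hv.symm.trans ha
      rw [lead_of_val_eq ha, lead_of_val_eq hb] at h
      rw [lt_val_iff]
      intro δ hδ
      rw [coeff_add]
      rcases hδ.lt_or_eq with hlt | rfl
      · rw [coeff_eq_zero_of_val_eq ha hlt,
          coeff_eq_zero_of_val_eq hb hlt, zero_oplus]
      · exact h
  · refine Or.inr ⟨h, ?_⟩
    rcases lt_trichotomy (val a) (val b) with hlt | he | hlt
    · rw [lead_add_of_val_lt hlt, oplus_eq_left_of_val_lt (by rwa [val_lead, val_lead])]
    · induction ha : val a with
      | top =>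
        rw [val_eq_top_iff.1 ha, zero_add, lead_zero, zero_oplus]
      | coe γ =>
        have hb := he.symm.trans ha
        rw [lead_of_val_eq ha, lead_of_val_eq hb] at h ⊢
        refine lead_of_val_eq (val_eq_of_coeff h fun δ hδ => ?_)
        rw [coeff_add, coeff_eq_zero_of_val_eq ha hδ,
          coeff_eq_zero_of_val_eq hb hδ, zero_oplus]
    · rw [add_comm, lead_add_of_val_lt hlt, oplus_comm,
        oplus_eq_left_of_val_lt (by rwa [val_lead, val_lead])]

/-- If `a ⊕ b = 0`, the monomials of `a` and `b` cancel. Adding to the second one the monomial of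
`c`, which is zero or of larger value, keeps its leading coefficient and leaves `c` as the sum. -/
theorem exists_lead_add_eq {a b c : H} (h : c ∈ hyperadd a b) :
    ∃ x y : HahnField H, lead x = a ∧ lead y = b ∧ lead (x + y) = c := by
  rcases h with ⟨h, hc⟩ | ⟨h, rfl⟩
  · have hy : lead (monomial b + monomial c) = b := by
      rcases hc with rfl | hc
      · rw [monomial_zero, add_zero, lead_monomial]
      · rw [lead_add_of_val_lt, lead_monomial]
        rwa [val_monomial, val_monomial, ← val_eq_of_oplus_eq_zero h]
    refine ⟨monomial a, monomial b + monomial c, lead_monomial a, hy, ?_⟩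
    rw [← add_assoc, monomial_add_of_oplus_eq_zero h, zero_add, lead_monomial]
  · refine ⟨monomial a, monomial b, lead_monomial a, lead_monomial b, ?_⟩
    have := lead_add_mem_hyperadd (monomial a) (monomial b)
    rw [lead_monomial, lead_monomial] at this
    rcases this with ⟨h0, -⟩ | ⟨-, h1⟩
    · exact absurd h0 h
    · exact h1

end HahnField

/-! ### Fixed points of contractions, inverses, henselianity. -/

namespace HahnField

open RVSort

variable {H : Type*} [RVSort H]

theorem val_sub_comm (a b : HahnField H) : val (a - b) = val (b - a) :=
  (addValuation H).map_sub_swap a b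

theorem lt_val_sub_iff {a b : HahnField H} {γ : ValueGroup H} :
    γ < val (a - b) ↔ ∀ δ ≤ γ, a.coeff δ = b.coeff δ := by
  rw [lt_val_iff]
  refine forall₂_congr fun δ _ => ⟨fun h => ?_, fun h => ?_⟩
  · conv_lhs => rw [← sub_add_cancel a b, coeff_add, h, zero_oplus]
  · rw [sub_eq_add_neg, coeff_add, coeff_neg, h, oplus_negOne_mul]

theorem lt_val_sub_trans {a b c : HahnField H} {γ : ValueGroup H} (hab : γ < val (a - b))
    (hbc : γ < val (b - c)) : γ < val (a - c) := by
  rw [lt_val_sub_iff] at *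
  exact fun δ hδ => (hab δ hδ).trans (hbc δ hδ)

theorem val_lt_val_mul {a b : HahnField H} (ha : 0 < val a) (hb : b ≠ 0) :
    val b < val (b * a) := by
  rw [val_mul]
  induction h : val b with
  | top => exact absurd (val_eq_top_iff.1 h) hb
  | coe γ =>
    induction h' : val a with
    | top => rw [add_top]; exact WithTop.coe_lt_top _
    | coe δ =>
      rw [h'] at ha
      exact WithTop.coe_lt_coe.2 (lt_add_of_pos_right γ (WithTop.coe_pos.1 ha))

/-- Approximate fixed points of a strictly contracting map are close to each other. -/
theorem lt_val_sub_of_lt_val_sub_map {N : HahnField H → HahnField H} {x y : HahnField H}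
    {γ : ValueGroup H} (hN : x ≠ y → val (x - y) < val (N x - N y))
    (hx : γ < val (x - N x)) (hy : γ < val (y - N y)) : γ < val (x - y) := by
  by_contra hle
  rw [not_lt] at hle
  have hxy : x ≠ y := by
    rintro rfl
    rw [sub_self, val_zero] at hle
    simp at hle
  -- All three terms have value greater than `val (x - y)`, which is absurd for their sum.
  have e : x - y = (x - N x) + (N x - N y) + (N y - y) := by ring
  have h : val (x - y) < val ((x - N x) + (N x - N y) + (N y - y)) :=
    (addValuation H).map_lt_add ((addValuation H).map_lt_add (hle.trans_lt hx) (hN hxy))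
      (hle.trans_lt (by rwa [val_sub_comm] at hy))
  rw [← e] at h
  exact h.false

/-- Families that are indexed by an initial segment of values and agree with each other up to the
smaller value have a common limit. -/
theorem exists_forall_lt_val_sub {P : ValueGroup H → Prop} (hP : ∀ γ δ, δ ≤ γ → P γ → P δ)
    (x : ValueGroup H → HahnField H)
    (hx : ∀ γ δ, δ ≤ γ → P γ → δ < val (x γ - x δ)) :
    ∃ y : HahnField H, ∀ γ, P γ → γ < val (y - x γ) := by
  classical
  have key : ∀ γ, P γ → ∀ δ ≤ γ, (x δ).coeff δ = (x γ).coeff δ := fun γ hγ δ hδ =>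
    (lt_val_sub_iff.1 (hx γ δ hδ hγ) δ le_rfl).symm
  -- The limit is the diagonal family: its entry at `γ` is that of `x γ`.
  refine ⟨⟨fun γ => if P γ then (x γ).coeff γ else 0, fun γ => ?_, ?_⟩, fun γ hγ => ?_⟩
  · split_ifs
    · exact (x γ).val_coeff γ
    · exact Or.inr RVSort.val_zero
  -- A descending sequence stays below its first term `f 0`, where the diagonal agrees with the
  -- single family `x (f 0)`.
  · rw [Set.isWF_iff_no_descending_seq]
    intro f hf hmem
    refine Set.isWF_iff_no_descending_seq.1 (x (f 0)).isWF_support f hf fun n => ?_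
    have h0 : P (f 0) := by_contra fun h => hmem 0 (if_neg h)
    have hle : f n ≤ f 0 := hf.antitone (Nat.zero_le n)
    have hn := hmem n
    rw [Set.mem_ofPred_eq, if_pos (hP _ _ hle h0), key _ h0 _ hle] at hn
    exact hn
  · rw [lt_val_sub_iff]
    intro δ hδ
    exact (if_pos (hP _ _ hδ hγ)).trans (key γ hγ δ hδ)

/-- A strictly contracting map of an open ball into itself has a fixed point. -/
theorem exists_fixedPoint (c : HahnField H) (N : HahnField H → HahnField H)
    (hmaps : ∀ x, 0 < val (x - c) → 0 < val (N x - c))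
    (hN : ∀ x y, 0 < val (x - c) → 0 < val (y - c) → x ≠ y → val (x - y) < val (N x - N y)) :
    ∃ x, 0 < val (x - c) ∧ N x = x := by
  -- `P γ` says that the ball contains a fixed point up to precision `γ`. A limit of such
  -- approximations is at least as precise as each of them.
  let P : ValueGroup H → Prop := fun γ => ∃ x, 0 < val (x - c) ∧ γ < val (x - N x)
  have hP : ∀ γ δ, δ ≤ γ → P γ → P δ := fun γ δ hδ ⟨x, hx, hxN⟩ =>
    ⟨x, hx, (WithTop.coe_le_coe.2 hδ).trans_lt hxN⟩
  have hc : 0 < val (c - c) := by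
    rw [sub_self, val_zero]
    exact WithTop.coe_lt_top 0
  have hP0 : P 0 := ⟨c, hc, by rw [val_sub_comm]; exact hmaps c hc⟩
  have hex : ∀ γ, ∃ x, P γ → 0 < val (x - c) ∧ γ < val (x - N x) := fun γ => by
    by_cases h : P γ
    · exact ⟨h.choose, fun _ => h.choose_spec⟩
    · exact ⟨c, fun h' => absurd h' h⟩
  choose x hx using hex
  obtain ⟨y, hy⟩ := exists_forall_lt_val_sub hP x fun γ δ hδ hγ =>
    lt_val_sub_of_lt_val_sub_map
      (hN _ _ (hx γ hγ).1 (hx δ (hP _ _ hδ hγ)).1)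
      ((WithTop.coe_le_coe.2 hδ).trans_lt (hx γ hγ).2) (hx δ (hP _ _ hδ hγ)).2
  have hyc : 0 < val (y - c) := lt_val_sub_trans (hy 0 hP0) (hx 0 hP0).1
  have hyN : ∀ γ, P γ → γ < val (y - N y) := fun γ hγ => by
    have h1 := hy γ hγ
    have h2 : γ < val (N (x γ) - N y) := by
      by_cases h : x γ = y
      · rw [h, sub_self, val_zero]
        exact WithTop.coe_lt_top γ
      · rw [val_sub_comm] at h1
        exact h1.trans (hN _ _ (hx γ hγ).1 hyc h)
    exact lt_val_sub_trans (lt_val_sub_trans (hy γ hγ) (hx γ hγ).2) h2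
  refine ⟨y, hyc, ?_⟩
  -- If `y` were not fixed, `N y` would be a fixed point up to precision `γ = val (y - N y)`; so `P
  -- γ` holds and `y` itself has precision beyond `γ`, a contradiction.
  by_contra hne
  induction hv : val (y - N y) with
  | top => exact hne (sub_eq_zero.1 (val_eq_top_iff.1 hv)).symm
  | coe γ =>
    have hPγ : P γ := ⟨N y, hmaps y hyc, by
      rw [← hv]
      exact hN y (N y) hyc (hmaps y hyc) (Ne.symm hne)⟩
    have := hyN γ hPγ
    rw [hv] at this
    exact this.false

/-- The map `x ↦ x - (b x - 1)` multiplies differences by `1 - b`, which has positive value; its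
fixed points are the inverses of `b`. -/
theorem exists_mul_eq_one_of_val_sub_one_pos {b : HahnField H} (hb : 0 < val (b - 1)) :
    ∃ x, b * x = 1 := by
  rw [val_sub_comm] at hb
  suffices h : ∃ x, 0 < val (x - 1) ∧ x - (b * x - 1) = x by
    obtain ⟨x, -, hx⟩ := h
    exact ⟨x, sub_eq_zero.1 (sub_eq_self.1 hx)⟩
  refine exists_fixedPoint 1 (fun x => x - (b * x - 1)) (fun x hx => ?_) (fun x y _ _ hxy => ?_)
  · have hx0 : val x = 0 := by
      have := (addValuation H).map_add_eq_of_lt_left (x := 1) (y := x - 1)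
        (by rw [AddValuation.map_one]; exact hx)
      rw [add_sub_cancel, AddValuation.map_one] at this
      exact this
    rw [show x - (b * x - 1) - 1 = (1 - b) * x by ring, val_mul, hx0, add_zero]
    exact hb
  · rw [show x - (b * x - 1) - (y - (b * y - 1)) = (x - y) * (1 - b) by ring]
    exact val_lt_val_mul hb (sub_ne_zero.2 hxy)

scoped instance : Nontrivial (HahnField H) :=
  ⟨1, 0, fun h => rv_one_ne_zero (H := H) (by rw [← lead_one, h, lead_zero])⟩

/-- Multiplying by the monomial of the inverse leading coefficient moves `a` into `1 + 𝔪`. -/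
theorem exists_mul_eq_one {a : HahnField H} (ha : a ≠ 0) : ∃ x, a * x = 1 := by
  have hl : lead (a * monomial (lead a)⁻¹) = lead (1 : HahnField H) := by
    rw [lead_mul, lead_monomial, lead_one, mul_inv_cancel₀ (mt lead_eq_zero_iff.1 ha)]
  rw [lead_eq_lead_iff one_ne_zero, val_hahn_one] at hl
  obtain ⟨x, hx⟩ := exists_mul_eq_one_of_val_sub_one_pos hl
  exact ⟨monomial (lead a)⁻¹ * x, by rw [← mul_assoc, hx]⟩

open Classical in
noncomputable scoped instance instField : Field (HahnField H) where
  inv a := if h : a = 0 then 0 else (exists_mul_eq_one h).choose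
  mul_inv_cancel a ha := by
    change a * dite _ _ _ = 1
    rw [dif_neg ha]
    exact (exists_mul_eq_one ha).choose_spec
  inv_zero := dif_pos rfl
  nnqsmul := _
  nnqsmul_def _ _ := rfl
  qsmul := _
  qsmul_def _ _ := rfl

variable (H) in
/-- The valuation ring. -/
noncomputable abbrev integerRing : ValuationSubring (HahnField H) :=
  (addValuation H).toValuation.valuationSubring

/-- `toValuation` reverses the order and writes values multiplicatively, so `≤ 1` unfolds to `0 ≤`.
-/
theorem mem_valuationSubring_iff {a : HahnField H} :
    a ∈ integerRing H ↔ 0 ≤ val a := Iff.rfl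

theorem mem_maximalIdeal_iff {a : integerRing H} :
    a ∈ IsLocalRing.maximalIdeal (integerRing H) ↔
      0 < val (a : HahnField H) := by
  rw [ValuationSubring.valuation_lt_one_iff, ← Valuation.isEquiv_iff_val_lt_one.1
    (addValuation H).toValuation.isEquiv_valuation_valuationSubring]
  exact Iff.rfl

-- Newton's map `x ↦ x - f(x) u` with the constant slope `u = f'(a₀)⁻¹` contracts the ball `a₀ + 𝔪`,
-- because `1 - u f'(y)` lies in `𝔪` for all `y` in that ball. Its fixed points are the roots of
-- `f`.
open Polynomial in
theorem henselianLocalRing :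
    HenselianLocalRing (integerRing H) where
  is_henselian f _ a₀ h₀ h₁ := by
    obtain ⟨u, hu⟩ := h₁.exists_right_inv
    -- The fixed point theorem lives on the whole field, so `f` is mapped there; `lift` brings
    -- points of the ball back to the valuation ring.
    let N : HahnField H → HahnField H := fun x =>
      x - (f.map (integerRing H).subtype).eval x * (u : HahnField H)
    have hNO : ∀ x : integerRing H, N x = ((x - f.eval x * u : integerRing H) : HahnField H) :=
        fun x => by
      have : (f.map (integerRing H).subtype).eval ((integerRing H).subtype x) =
          (integerRing H).subtype (f.eval x) :=
        Polynomial.eval_map_apply _ _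
      exact congrArg (fun z => (x : HahnField H) - z * u) this
    have lift : ∀ x : HahnField H, 0 < val (x - (a₀ : HahnField H)) →
        ∃ y : integerRing H, (y : HahnField H) = x ∧
          y - a₀ ∈ IsLocalRing.maximalIdeal (integerRing H) := fun x hx =>
      ⟨⟨x - (a₀ : HahnField H), mem_valuationSubring_iff.2 hx.le⟩ + a₀, sub_add_cancel _ _, by
        rw [add_sub_cancel_right]
        exact mem_maximalIdeal_iff.2 hx⟩
    suffices h : ∃ x, 0 < val (x - (a₀ : HahnField H)) ∧ N x = x by
      obtain ⟨x, hx, hfx⟩ := h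
      obtain ⟨x, rfl, hx'⟩ := lift x hx
      refine ⟨x, ?_, hx'⟩
      rw [hNO, Subtype.coe_inj, sub_eq_self] at hfx
      exact (mul_eq_zero.1 hfx).resolve_right (right_ne_zero_of_mul_eq_one hu)
    refine exists_fixedPoint (a₀ : HahnField H) N (fun x hx => ?_) (fun x y hx hy hxy => ?_)
    · obtain ⟨x, rfl, hx'⟩ := lift x hx
      rw [hNO]
      refine mem_maximalIdeal_iff.1 (?_ : x - f.eval x * u - a₀ ∈ _)
      obtain ⟨q, hq⟩ := f.sub_dvd_eval_sub x a₀
      rw [show x - f.eval x * u - a₀ = (x - a₀) * (1 - q * u) - f.eval a₀ * u by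
        linear_combination -u * hq]
      exact sub_mem (Ideal.mul_mem_right _ _ hx') (Ideal.mul_mem_right _ _ h₀)
    · obtain ⟨x, rfl, hx'⟩ := lift x hx
      obtain ⟨y, rfl, hy'⟩ := lift y hy
      -- Expand `f` at `y` to second order and replace `f'(y)` by `f'(a₀) + (y - a₀) q`. The linear
      -- term cancels since `f'(a₀) u = 1`, which leaves a contraction factor in `𝔪`.
      obtain ⟨k, hk⟩ := f.binomExpansion y (x - y)
      obtain ⟨q, hq⟩ := f.derivative.sub_dvd_eval_sub y a₀
      rw [add_sub_cancel] at hk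
      have hm : -u * ((y - a₀) * q + k * (x - y)) ∈ IsLocalRing.maximalIdeal (integerRing H) := by
        refine Ideal.mul_mem_left _ _ (add_mem (Ideal.mul_mem_right _ _ hy')
          (Ideal.mul_mem_left _ _ ?_))
        rw [← sub_sub_sub_cancel_right x y a₀]
        exact sub_mem hx' hy'
      have e : x - f.eval x * u - (y - f.eval y * u) =
          (x - y) * (-u * ((y - a₀) * q + k * (x - y))) := by
        linear_combination -u * hk - u * (x - y) * hq - (x - y) * hu
      have e' : N x - N y =
          (x - y : HahnField H) * (-u * ((y - a₀) * q + k * (x - y)) : integerRing H) := by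
        rw [hNO, hNO]
        exact congrArg (integerRing H).subtype e
      rw [e']
      exact val_lt_val_mul (mem_maximalIdeal_iff.1 hm) (sub_ne_zero.2 hxy)

end HahnField

/-! ### The factor hyperfield modulo `1 + 𝔪`. -/

namespace HahnField

open RVSort ValuedHyperfield

variable {H : Type*} [RVSort H]

variable (H) in
/-- The leading coefficient as a homomorphism of multiplicative groups. -/
noncomputable def leadUnits : (HahnField H)ˣ →* Hˣ :=
  Units.map { toFun := lead, map_one' := lead_one, map_mul' := lead_mul }

theorem leadUnits_apply (u : (HahnField H)ˣ) : (leadUnits H u : H) = lead (u : HahnField H) := rfl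

theorem leadUnits_surjective : Function.Surjective (leadUnits H) := fun a => by
  have h : monomial (a : H) ≠ 0 := fun h =>
    a.ne_zero (by rw [← lead_monomial (a : H), h, lead_zero])
  exact ⟨Units.mk0 _ h, Units.ext (lead_monomial (a : H))⟩

variable (H) in
/-- The group `1 + 𝔪`. -/
noncomputable abbrev oneAddMaximalIdeal : Subgroup (HahnField H)ˣ :=
  oneAddIdeal (addValuation H) {0} rfl

theorem mem_oneAddMaximalIdeal_iff {u : (HahnField H)ˣ} :
    u ∈ oneAddMaximalIdeal H ↔ lead (u : HahnField H) = 1 := by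
  rw [← lead_one, lead_eq_lead_iff one_ne_zero, val_hahn_one]
  exact ⟨fun h => h 0 rfl, fun h r hr => by rw [Set.mem_singleton_iff.1 hr]; exact h⟩

theorem oneAddMaximalIdeal_eq_ker : oneAddMaximalIdeal H = (leadUnits H).ker := by
  ext u
  rw [mem_oneAddMaximalIdeal_iff, MonoidHom.mem_ker, Units.ext_iff, leadUnits_apply, Units.val_one]

open Classical in
variable (H) in
/-- The factor hyperfield modulo `1 + 𝔪` is isomorphic to the RV-sort by taking leading
coefficients. -/
noncomputable def factorEquiv : Factor (oneAddMaximalIdeal H) ≃* H :=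
  (MulEquiv.withZero ((QuotientGroup.quotientMulEquivOfEq oneAddMaximalIdeal_eq_ker).trans
    (QuotientGroup.quotientKerEquivOfSurjective (leadUnits H) leadUnits_surjective))).trans
    WithZero.withZeroUnitsEquiv

theorem factorEquiv_cls (x : HahnField H) :
    factorEquiv H (cls (oneAddMaximalIdeal H) x) = lead x := by
  by_cases h : x = 0
  · rw [cls, dif_pos h, h, lead_zero]
    exact map_zero (factorEquiv H)
  · rw [cls, dif_neg h]
    rfl

/-- Elements `t` of `1 + 𝔪` have leading coefficient `1`, so `y` and `y t` have the same one.
Conversely, the representatives `x` and `y` may be chosen freely in their classes, so `t = 1`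
already yields every element of the hypersum. -/
theorem factorEquiv_image_factorHyperadd (X Y : Factor (oneAddMaximalIdeal H)) :
    factorEquiv H '' factorHyperadd (oneAddMaximalIdeal H) X Y =
      hyperadd (factorEquiv H X) (factorEquiv H Y) := by
  ext c
  constructor
  · rintro ⟨_, ⟨x, y, rfl, rfl, t, ht, rfl⟩, rfl⟩
    rw [factorEquiv_cls, factorEquiv_cls, factorEquiv_cls]
    have := lead_add_mem_hyperadd x (y * t)
    rwa [lead_mul, mem_oneAddMaximalIdeal_iff.1 ht, mul_one] at this
  · intro hc
    obtain ⟨x, y, hx, hy, hxy⟩ := exists_lead_add_eq hc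
    refine ⟨cls _ (x + y * (1 : (HahnField H)ˣ)),
      ⟨x, y, (factorEquiv H).injective ?_, (factorEquiv H).injective ?_, 1, one_mem _, rfl⟩, ?_⟩
    · rw [factorEquiv_cls, hx]
    · rw [factorEquiv_cls, hy]
    · rw [factorEquiv_cls, Units.val_one, mul_one, hxy]

end HahnField

open RVSort ValuedHyperfield in
theorem mainTheorem3 {H : Type*} [RVSort H] :
    ∃ (_ : Field (HahnField H)) (v : AddValuation (HahnField H) (WithTop (ValueGroup H))),
      (∀ a b : HahnField H, a + b = HahnField.add a b) ∧
      (∀ a b : HahnField H, a * b = HahnField.mul a b) ∧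
      (0 : HahnField H) = HahnField.zero ∧
      (1 : HahnField H) = HahnField.one ∧
      (∀ a : HahnField H, v a = HahnField.val a) ∧
      HenselianLocalRing v.toValuation.valuationSubring ∧
      ∃ e : Factor (oneAddIdeal v {0} rfl) ≃ H,
        e 0 = 0 ∧ e 1 = 1 ∧
        (∀ X Y, e (X * Y) = e X * e Y) ∧
        (∀ X Y, e '' factorHyperadd (oneAddIdeal v {0} rfl) X Y = hyperadd (e X) (e Y)) ∧
        (∀ x : HahnField H, RVSort.val (e (cls (oneAddIdeal v {0} rfl) x)) = v x) := by
  open scoped HahnField in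
  refine ⟨HahnField.instField, HahnField.addValuation H, fun _ _ => rfl, fun _ _ => rfl, rfl, rfl,
    fun _ => rfl, HahnField.henselianLocalRing, (HahnField.factorEquiv H).toEquiv,
    map_zero (HahnField.factorEquiv H), map_one (HahnField.factorEquiv H),
    map_mul (HahnField.factorEquiv H), HahnField.factorEquiv_image_factorHyperadd, fun x => ?_⟩
  exact (congrArg RVSort.val (HahnField.factorEquiv_cls x)).trans (HahnField.val_lead x)
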